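/- Let $S$ be a K3 surface, let $k\ge 2$, and let $\Lambda=\Lambda_k=H^2(S^{[k]},\mathbb Z)=H^2(S,\mathbb Z)\oplus\mathbb Z e$ with its Beauville–Bogomolov–Fujiki form $q$; that is, $H^2(S,\mathbb Z)$ with its intersection form is the K3 lattice $U^{\oplus 3}\oplus E_8(-1)^{\oplus 2}$, the sum is orthogonal, and $q(e,e)=-2(k-1)$. Let $\tilde O(\Lambda)$ be the group of isometries of $\Lambda$ acting trivially on the discriminant group $\Lambda^*/\Lambda$. Let $\mathrm{Mon}(\Lambda)\subset O(\Lambda)$ be the monodromy group, which by Markman's theorem is the subgroup generated by the reflections $x\mapsto x+q(x,u)u$ in the vectors $u$ with $q(u,u)=-2$ and the antireflections $x\mapsto -x+q(x,u)u$ in the vectors $u$ with $q(u,u)=2$. For $v\in\Lambda$ let $\langle v,e\rangle$ be the sublattice generated by $v$ and $e$. 1. Let $k=2$ and let $z\in\Lambda$ be primitive with $q(z,z)<0$. There exists $\gamma\in\tilde O(\Lambda)\cap\mathrm{Mon}(\Lambda)$ such that $\langle\gamma(z),e\rangle$ has rank $2$ and is negative definite if and only if $z$ and $e$ do not belong to the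 same $\tilde O(\Lambda)$-orbit. 2. Let $3\le k\le 5$. For every primitive $z\in\Lambda$ with $q(z,z)<0$ there exists $\gamma\in\tilde O(\Lambda)\cap\mathrm{Mon}(\Lambda)$ such that $\langle\gamma(z),e\rangle$ has rank $2$ and is negative semidefinite. 3. For every $k\ge 6$ (in particular for $k=6$) this fails: there is a primitive $z\in\Lambda$ with $q(z,z)<0$ such that for no $\gamma\in\tilde O(\Lambda)\cup\mathrm{Mon}(\Lambda)$ the lattice $\langle\gamma(z),e\rangle$ is negative semidefinite. -/

import Mathlib

open Matrix

noncomputable section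

/-- The underlying group of the K3 lattice `U ⊕ U ⊕ U ⊕ E₈(-1) ⊕ E₈(-1)`, which is
`H²(S, ℤ)` with its intersection form for every K3 surface `S`. -/
abbrev K3Lattice : Type := (Fin 3 → ℤ × ℤ) × (Fin 2 → Fin 8 → ℤ)

/-- The intersection form of the K3 lattice: three hyperbolic planes `U` with Gram matrix
`!![0, 1; 1, 0]`, and two copies of the `E₈` lattice with the negated form. -/
def k3Form : LinearMap.BilinForm ℤ K3Lattice :=
  LinearMap.mk₂ ℤ
    (fun x y =>
      (∑ i, ((x.1 i).1 * (y.1 i).2 + (x.1 i).2 * (y.1 i).1))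
        - ∑ j, x.2 j ⬝ᵥ (CartanMatrix.E₈ *ᵥ y.2 j))
    (by
      intro x x' y
      simp only [Prod.fst_add, Prod.snd_add, Pi.add_apply, add_dotProduct, add_mul,
        Finset.sum_add_distrib]
      ring)
    (by
      intro c x y
      simp only [Prod.smul_fst, Prod.smul_snd, Pi.smul_apply, smul_dotProduct, smul_eq_mul,
        mul_assoc, Finset.sum_add_distrib, ← Finset.mul_sum]
      ring)
    (by
      intro x y y'
      simp only [Prod.fst_add, Prod.snd_add, Pi.add_apply, mulVec_add, dotProduct_add, mul_add,
        Finset.sum_add_distrib]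
      ring)
    (by
      intro c x y
      simp only [Prod.smul_fst, Prod.smul_snd, Pi.smul_apply, mulVec_smul, dotProduct_smul,
        smul_eq_mul, mul_left_comm _ c, Finset.sum_add_distrib, ← Finset.mul_sum]
      ring)

/-- The underlying group of `H²(S^[k], ℤ) = H²(S, ℤ) ⊕ ℤ e`. -/
abbrev HilbLattice : Type := K3Lattice × ℤ

/-- The Beauville-Bogomolov-Fujiki form of `S^[k]`: the orthogonal sum of the intersection form
of `H²(S, ℤ)` and of `ℤ e` with `q(e, e) = -2 (k - 1)`. -/
def bbfForm (k : ℕ) : LinearMap.BilinForm ℤ HilbLattice :=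
  LinearMap.mk₂ ℤ (fun x y => k3Form x.1 y.1 + -2 * ((k : ℤ) - 1) * (x.2 * y.2))
    (by intro x x' y; simp only [Prod.fst_add, Prod.snd_add, map_add, LinearMap.add_apply]; ring)
    (by
      intro c x y
      simp only [Prod.smul_fst, Prod.smul_snd, map_smul, LinearMap.smul_apply, smul_eq_mul]; ring)
    (by intro x y y'; simp only [Prod.fst_add, Prod.snd_add, map_add]; ring)
    (by intro c x y; simp only [Prod.smul_fst, Prod.smul_snd, map_smul, smul_eq_mul]; ring)

/-- The class `e`, one half of the class of the diagonal. -/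
def diagClass : HilbLattice := (0, 1)

section Lattice

variable {L : Type*} [AddCommGroup L]

/-- The orthogonal group `O(L)` of a lattice `(L, B)`. -/
def isometryGroup (B : LinearMap.BilinForm ℤ L) : Subgroup (L ≃ₗ[ℤ] L) where
  carrier := {γ | ∀ x y, B (γ x) (γ y) = B x y}
  one_mem' := fun _ _ => rfl
  mul_mem' := by
    intro γ γ' h h' x y
    rw [LinearEquiv.mul_apply, LinearEquiv.mul_apply, h, h']
  inv_mem' := by
    intro γ h x y
    have := h (γ.symm x) (γ.symm y)
    rw [γ.apply_symm_apply, γ.apply_symm_apply] at this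
    exact this.symm

/-- The discriminant group `L* / L`, where `L* = Hom(L, ℤ)` and `L` is mapped to `L*` by
`x ↦ B(x, ·)`. -/
abbrev DiscriminantGroup (B : LinearMap.BilinForm ℤ L) : Type _ :=
  Module.Dual ℤ L ⧸ LinearMap.range B

/-- The endomorphism of `L* / L` induced by the action `f ↦ f ∘ γ⁻¹` of an isometry `γ` on `L*`
(which is compatible with the action of `γ` on `L`). -/
def discriminantAction (B : LinearMap.BilinForm ℤ L) (γ : isometryGroup B) :
    DiscriminantGroup B →ₗ[ℤ] DiscriminantGroup B :=
  Submodule.mapQ (LinearMap.range B) (LinearMap.range B) (γ.1.symm.toLinearMap.dualMap) (by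
    rintro _ ⟨x, rfl⟩
    refine ⟨γ.1 x, LinearMap.ext fun y => ?_⟩
    have := γ.2 x (γ.1.symm y)
    rw [γ.1.apply_symm_apply] at this
    exact this)

/-- The stable orthogonal group `Õ(L)`: the isometries of `(L, B)` which act trivially on the
discriminant group. -/
def stableOrthogonalGroup (B : LinearMap.BilinForm ℤ L) : Subgroup (L ≃ₗ[ℤ] L) where
  carrier := {γ | ∃ hγ : γ ∈ isometryGroup B, ∀ a, discriminantAction B ⟨γ, hγ⟩ a = a}
  one_mem' := ⟨one_mem _, fun a => by
    obtain ⟨f, rfl⟩ := Submodule.Quotient.mk_surjective _ a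
    rfl⟩
  mul_mem' := by
    rintro γ γ' ⟨h, hγ⟩ ⟨h', hγ'⟩
    refine ⟨mul_mem h h', fun a => ?_⟩
    calc discriminantAction B ⟨γ * γ', mul_mem h h'⟩ a
        = discriminantAction B ⟨γ, h⟩ (discriminantAction B ⟨γ', h'⟩ a) := by
          obtain ⟨f, rfl⟩ := Submodule.Quotient.mk_surjective _ a
          rfl
      _ = a := by rw [hγ', hγ]
  inv_mem' := by
    rintro γ ⟨h, hγ⟩
    refine ⟨inv_mem h, fun a => ?_⟩
    calc discriminantAction B ⟨γ⁻¹, inv_mem h⟩ a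
        = discriminantAction B ⟨γ⁻¹, inv_mem h⟩ (discriminantAction B ⟨γ, h⟩ a) := by rw [hγ]
      _ = a := by
          obtain ⟨f, rfl⟩ := Submodule.Quotient.mk_surjective _ a
          refine congrArg (Submodule.Quotient.mk (p := LinearMap.range B)) ?_
          exact LinearMap.ext fun x => congrArg f (γ.symm_apply_apply x)

/-- The monodromy group of the lattice `(L, B) = H²(M, ℤ)` of a manifold `M` of K3^[n] type, in
Markman's description: the subgroup of `O(L)` generated by the transformations
`ρ_u(x) = -2 x / q(u) + q(x, u) u` with `q(u) = ± 2`, that is, by the reflections in the classes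
`u` of square `-2` and the antireflections in the classes `u` of square `2`. -/
def monodromyGroup (B : LinearMap.BilinForm ℤ L) : Subgroup (L ≃ₗ[ℤ] L) :=
  Subgroup.closure
    {γ | γ ∈ isometryGroup B ∧ ∃ u : L,
      (B u u = -2 ∧ ∀ x, γ x = x + B x u • u) ∨ (B u u = 2 ∧ ∀ x, γ x = -x + B x u • u)}

/-- A primitive vector: nonzero (take `n = 0`) and not divisible by an integer other than `± 1`. -/
def IsPrimitiveVector (z : L) : Prop :=
  ∀ (n : ℤ) (w : L), z = n • w → IsUnit n

/-- The sublattice `⟨v, w⟩` generated by two vectors. -/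
abbrev pairLattice (v w : L) : Submodule ℤ L := Submodule.span ℤ {v, w}

/-- The restriction of the form `B` to the sublattice `N` is negative definite. -/
def NegDefOn (B : LinearMap.BilinForm ℤ L) (N : Submodule ℤ L) : Prop :=
  ∀ x ∈ N, x ≠ 0 → B x x < 0

/-- The restriction of the form `B` to the sublattice `N` is negative semidefinite. -/
def NegSemidefOn (B : LinearMap.BilinForm ℤ L) (N : Submodule ℤ L) : Prop :=
  ∀ x ∈ N, B x x ≤ 0

end Lattice

end

/-!
Write a vector of `Λ = H²(S, ℤ) ⊕ ℤ e` as `z = x + a e`, and put `t = k - 1`. The lattice `⟨z, e⟩`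
is spanned over `ℚ` by `x` and `e`, so it has rank `2` and is negative definite (semidefinite) as
soon as `x ≠ 0` and `x² < 0` (`x² ≤ 0`).

The reflections in vectors of square `-2` belong to `Õ ∩ Mon` (`exists_reflection_mem`). The
reflection in `u + e`, with `u ∈ H²(S, ℤ)` and `u² = 2 t - 2`, replaces `a` by
`(1 - 2 t) a + (x, u)`. As the K3 lattice is unimodular and contains a hyperbolic plane orthogonal
to `x`, the product `(x, u)` can be any multiple of the divisibility `c` of `x`
(`exists_k3Form_eq`). Therefore a vector of the orbit of `z` for which `|a|` is minimal satisfies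
`2 |a| ≤ c` (`HasMinimalCoeff.two_mul_abs_le`). Writing `x = c x₀`, the inequality `z² < 0` gives
`c² x₀² < 2 t a² ≤ t c² / 2`, hence `x₀² < t / 2`. For `t ≤ 4` the even number `x₀²` is at most `0`
(`HasMinimalCoeff.k3Form_nonpos`), which proves the existence for `3 ≤ k ≤ 5`.

For `k = 2` the remaining case is `x² = 0`. A reflection in `u + e` with `u ⊥ x` changes the sign of
`a` and yields an `x` whose divisibility divides `2 a`; by minimality it is equal to `2 |a|`. As `z`
is primitive, `a = ± 1`, and `2 x₀ ± e` with `x₀² = 0` is carried to `± e` by one more reflection.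
Conversely a vector `2 x₀ + a e` of the orbit of `e` has `x₀² = (a² - 1) / 2 ≥ 0`.

For `k ≥ 6` take `z = 2 w + e` with `w² = 2`, so that `z² = 8 - 2 t < 0`. All products of `z` with
elements of `Λ` are even, so an isometry maps `z` to some `2 x₀ + a e` with `a ≠ 0`, and
`4 x₀² = 8 - 2 t + 2 t a² ≥ 8` is positive.
-/

/-! ### Reflections in vectors of square `-2` -/

section Reflections

variable {L : Type*} [AddCommGroup L] {B : LinearMap.BilinForm ℤ L}

/-- The reflection in a vector `u` of square `-2` preserves the form, acts trivially on the
discriminant group (it changes a functional `φ` by `B (φ u • u)`), and is a monodromy operator. -/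
theorem exists_reflection_mem (hB : ∀ x y, B x y = B y x) {u : L} (hu : B u u = -2) :
    ∃ γ ∈ stableOrthogonalGroup B ⊓ monodromyGroup B, ∀ x, γ x = x + B x u • u := by
  have h2 : (-B u) u = 2 := by simp [hu]
  have happly : ∀ x, Module.reflection h2 x = x + B x u • u := by
    intro x
    rw [Module.reflection_apply, LinearMap.neg_apply, neg_smul, sub_neg_eq_add, hB u x]
  have hiso : Module.reflection h2 ∈ isometryGroup B := by
    intro x y
    rw [happly, happly]
    simp only [map_add, map_smul, LinearMap.add_apply, LinearMap.smul_apply, smul_eq_mul, hu,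
      hB u y]
    ring
  refine ⟨Module.reflection h2, ⟨⟨hiso, fun a => ?_⟩, Subgroup.subset_closure
    ⟨hiso, u, Or.inl ⟨hu, happly⟩⟩⟩, happly⟩
  obtain ⟨φ, rfl⟩ := Submodule.Quotient.mk_surjective _ a
  refine (Submodule.Quotient.eq _).2 ⟨φ u • u, LinearMap.ext fun x => ?_⟩
  change B (φ u • u) x = φ (Module.reflection h2 x) - φ x
  rw [happly]
  simp only [map_add, map_smul, LinearMap.smul_apply, smul_eq_mul, hB u x]
  ring

theorem monodromyGroup_le_isometryGroup : monodromyGroup B ≤ isometryGroup B :=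
  (Subgroup.closure_le _).2 fun _ h => h.1

theorem IsPrimitiveVector.map {z : L} (hz : IsPrimitiveVector z) (γ : L ≃ₗ[ℤ] L) :
    IsPrimitiveVector (γ z) := by
  intro n w h
  refine hz n (γ.symm w) ?_
  rw [← map_smul, ← h, γ.symm_apply_apply]

theorem IsPrimitiveVector.ne_zero {z : L} (hz : IsPrimitiveVector z) : z ≠ 0 := fun h =>
  not_isUnit_zero (hz 0 0 (by rw [h, smul_zero]))

end Reflections

/-! ### The K3 lattice -/

theorem k3Form_apply (x y : K3Lattice) : k3Form x y =
    (∑ i, ((x.1 i).1 * (y.1 i).2 + (x.1 i).2 * (y.1 i).1))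
      - ∑ j, x.2 j ⬝ᵥ (CartanMatrix.E₈ *ᵥ y.2 j) := rfl

theorem k3Form_comm (x y : K3Lattice) : k3Form x y = k3Form y x := by
  rw [k3Form_apply, k3Form_apply]
  congr 1
  · exact Finset.sum_congr rfl fun i _ => by ring
  · refine Finset.sum_congr rfl fun j _ => ?_
    rw [dotProduct_mulVec, ← mulVec_transpose, CartanMatrix.E₈_transpose, dotProduct_comm]

theorem even_dotProduct_E₈_mulVec (v : Fin 8 → ℤ) : Even (v ⬝ᵥ (CartanMatrix.E₈ *ᵥ v)) := by
  refine ⟨v 0 ^ 2 + v 1 ^ 2 + v 2 ^ 2 + v 3 ^ 2 + v 4 ^ 2 + v 5 ^ 2 + v 6 ^ 2 + v 7 ^ 2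
    - v 0 * v 2 - v 1 * v 3 - v 2 * v 3 - v 3 * v 4 - v 4 * v 5 - v 5 * v 6 - v 6 * v 7, ?_⟩
  simp [dotProduct, mulVec, Fin.sum_univ_eight, CartanMatrix.E₈]
  ring

theorem even_k3Form_self (x : K3Lattice) : Even (k3Form x x) := by
  rw [k3Form_apply]
  refine Even.sub (Finset.even_sum _ fun i _ => ⟨(x.1 i).1 * (x.1 i).2, by ring⟩)
    (Finset.even_sum _ fun j _ => even_dotProduct_E₈_mulVec _)

/-- Unimodularity of the K3 lattice: a vector whose products with all vectors are divisible by
`c` is itself divisible by `c`. -/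
theorem exists_eq_smul_of_dvd_k3Form {c : ℤ} {x : K3Lattice} (h : ∀ y, c ∣ k3Form x y) :
    ∃ x₀, x = c • x₀ := by
  have h1 : ∀ i, c ∣ (x.1 i).1 := fun i => by
    have := h (Pi.single i (0, 1), 0)
    rw [k3Form_apply, Finset.sum_eq_single i] at this
    · simpa using this
    · intro j _ hj
      simp [Pi.single_eq_of_ne hj]
    · simp
  have h2 : ∀ i, c ∣ (x.1 i).2 := fun i => by
    have := h (Pi.single i (1, 0), 0)
    rw [k3Form_apply, Finset.sum_eq_single i] at this
    · simpa using this
    · intro j _ hj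
      simp [Pi.single_eq_of_ne hj]
    · simp
  have h3 : ∀ j l, c ∣ x.2 j l := fun j l => by
    obtain ⟨w, hw⟩ : ∃ w, CartanMatrix.E₈ *ᵥ w = Pi.single l 1 :=
      ⟨CartanMatrix.E₈⁻¹ *ᵥ Pi.single l 1, by
        rw [mulVec_mulVec, mul_nonsing_inv _ (by rw [CartanMatrix.E₈_det]; exact isUnit_one),
          one_mulVec]⟩
    have := h (0, Pi.single j w)
    rw [k3Form_apply, Finset.sum_eq_single (s := Finset.univ) (a := j) (f := fun j' => _ ⬝ᵥ _)]
      at this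
    · simpa [hw] using this
    · intro j' _ hj
      simp [Pi.single_eq_of_ne hj]
    · simp
  choose p hp using h1
  choose q hq using h2
  choose r hr using h3
  refine ⟨(fun i => (p i, q i), r), ?_⟩
  ext
  · exact hp _
  · exact hq _
  · exact hr _ _

/-- The generator `c` of the ideal of the values `k3Form x y`, for `x ≠ 0`, is the divisibility
of `x` as a vector. -/
theorem exists_divisibility {x : K3Lattice} (hx : x ≠ 0) :
    ∃ c : ℤ, 0 < c ∧ (∃ x₀, x = c • x₀) ∧ ∃ y, k3Form x y = c := by
  obtain ⟨c, hc⟩ := IsPrincipalIdealRing.principal (LinearMap.range (k3Form x))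
  have hdvd : ∀ y, c ∣ k3Form x y := fun y => by
    have : k3Form x y ∈ Submodule.span ℤ {c} := hc ▸ LinearMap.mem_range_self _ y
    exact Ideal.mem_span_singleton.1 this
  obtain ⟨y, hy⟩ : c ∈ LinearMap.range (k3Form x) := hc ▸ Submodule.mem_span_singleton_self c
  obtain ⟨x₀, hx₀⟩ := exists_eq_smul_of_dvd_k3Form hdvd
  rcases lt_trichotomy c 0 with h | h | h
  · exact ⟨-c, by omega, ⟨-x₀, by rw [hx₀, smul_neg, neg_smul, neg_neg]⟩, -y, by rw [map_neg, hy]⟩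
  · exact absurd (by rw [hx₀, h, zero_smul]) hx
  · exact ⟨c, h, ⟨x₀, hx₀⟩, y, hy⟩

/-! ### Vectors with prescribed products -/

/-- Bases `x, x'` and `y, y'` of `ℤ²` of determinant `1` such that the bilinear form with matrix
`!![a, b; c, d]` vanishes on `(x, y)` and on `(x', y')`; a form of the Smith normal form of a
`2 × 2` matrix. -/
def HasAntidiagonalBases (a b c d : ℤ) : Prop :=
  ∃ x₁ x₂ x₁' x₂' y₁ y₂ y₁' y₂' : ℤ,
    a * x₁ * y₁ + b * x₁ * y₂ + c * x₂ * y₁ + d * x₂ * y₂ = 0 ∧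
    a * x₁' * y₁' + b * x₁' * y₂' + c * x₂' * y₁' + d * x₂' * y₂' = 0 ∧
    x₁ * x₂' - x₂ * x₁' = 1 ∧ y₁ * y₂' - y₂ * y₁' = 1

namespace HasAntidiagonalBases

variable {a b c d : ℤ}

theorem of_transpose (h : HasAntidiagonalBases a c b d) : HasAntidiagonalBases a b c d := by
  obtain ⟨x₁, x₂, x₁', x₂', y₁, y₂, y₁', y₂', h₁, h₂, h₃, h₄⟩ := h
  exact ⟨y₁, y₂, y₁', y₂', x₁, x₂, x₁', x₂', by linear_combination h₁,
    by linear_combination h₂, h₄, h₃⟩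

theorem of_add_col (k : ℤ) (h : HasAntidiagonalBases a (b + k * a) c (d + k * c)) :
    HasAntidiagonalBases a b c d := by
  obtain ⟨x₁, x₂, x₁', x₂', y₁, y₂, y₁', y₂', h₁, h₂, h₃, h₄⟩ := h
  exact ⟨x₁, x₂, x₁', x₂', y₁ + k * y₂, y₂, y₁' + k * y₂', y₂', by linear_combination h₁,
    by linear_combination h₂, h₃, by linear_combination h₄⟩

theorem of_swap_col (h : HasAntidiagonalBases b (-a) d (-c)) : HasAntidiagonalBases a b c d := by
  obtain ⟨x₁, x₂, x₁', x₂', y₁, y₂, y₁', y₂', h₁, h₂, h₃, h₄⟩ := h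
  exact ⟨x₁, x₂, x₁', x₂', -y₂, y₁, -y₂', y₁', by linear_combination h₁,
    by linear_combination h₂, h₃, by linear_combination h₄⟩

theorem diagonal (a d : ℤ) : HasAntidiagonalBases a 0 0 d :=
  ⟨1, 0, 0, 1, 0, 1, -1, 0, by ring, by ring, by ring, by ring⟩

theorem of_ne_zero (n : ℕ) : ∀ a b c d : ℤ, a ≠ 0 → a.natAbs = n →
    HasAntidiagonalBases a b c d := by
  induction n using Nat.strong_induction_on with
  | _ n ih =>
    -- If `a` does not divide the entry `b` beside it, `b` can be replaced by its remainder.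
    have key : ∀ a b c d : ℤ, a ≠ 0 → a.natAbs = n → ¬ a ∣ b → HasAntidiagonalBases a b c d := by
      intro a b c d ha hn hab
      refine of_add_col (-(b / a)) (of_swap_col (ih (b % a).natAbs ?_ _ _ _ _ ?_ ?_))
      · rw [← hn]
        have h1 := Int.emod_nonneg b ha
        have h2 := Int.emod_lt_abs b ha
        rw [Int.abs_eq_natAbs] at h2
        omega
      · rw [neg_mul, ← sub_eq_add_neg, mul_comm, ← Int.emod_def]
        exact fun h => hab (Int.dvd_of_emod_eq_zero h)
      · rw [neg_mul, ← sub_eq_add_neg, mul_comm, ← Int.emod_def]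
    intro a b c d ha hn
    by_cases hab : a ∣ b
    · by_cases hac : a ∣ c
      · obtain ⟨k, rfl⟩ := hab
        obtain ⟨l, rfl⟩ := hac
        refine of_add_col (-k) (of_transpose (of_add_col (-l) ?_))
        rw [show a * l + -l * a = 0 by ring, show a * k + -k * a = 0 by ring, mul_zero, add_zero]
        exact diagonal _ _
      · exact of_transpose (key _ _ _ _ ha hn hac)
    · exact key _ _ _ _ ha hn hab

end HasAntidiagonalBases

theorem hasAntidiagonalBases (a b c d : ℤ) : HasAntidiagonalBases a b c d := by
  by_cases ha : a = 0
  · by_cases hb : b = 0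
    · by_cases hc : c = 0
      · rw [ha, hb, hc]
        exact .diagonal _ _
      · exact .of_transpose (.of_swap_col (.of_ne_zero _ _ _ _ _ hc rfl))
    · exact .of_swap_col (.of_ne_zero _ _ _ _ _ hb rfl)
  · exact .of_ne_zero _ _ _ _ _ ha rfl

/-- Every vector of the K3 lattice is orthogonal to a hyperbolic plane contained in the first two
summands `U`: these form the lattice of `2 × 2` matrices with the determinant as quadratic form,
where the matrices of rank `1` are isotropic. -/
theorem exists_orthogonal_hyperbolic_pair (x : K3Lattice) :
    ∃ h h' : K3Lattice, k3Form x h = 0 ∧ k3Form x h' = 0 ∧ k3Form h h = 0 ∧ k3Form h' h' = 0 ∧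
      k3Form h h' = 1 := by
  obtain ⟨x₁, x₂, x₁', x₂', y₁, y₂, y₁', y₂', h₁, h₂, h₃, h₄⟩ :=
    hasAntidiagonalBases (x.1 0).1 (x.1 1).1 (-(x.1 1).2) (x.1 0).2
  refine ⟨(![(x₂ * y₂, x₁ * y₁), (-(x₂ * y₁), x₁ * y₂), 0], 0),
    (![(x₂' * y₂', x₁' * y₁'), (-(x₂' * y₁'), x₁' * y₂'), 0], 0), ?_, ?_, ?_, ?_, ?_⟩ <;>
    simp [k3Form_apply, Fin.sum_univ_three]
  · linear_combination h₁
  · linear_combination h₂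
  · ring
  · ring
  · linear_combination (y₁ * y₂' - y₂ * y₁') * h₃ + h₄

/-- A vector `u` with a prescribed product with `x` and a prescribed even square exists; moreover
some vector `h` orthogonal to `x` satisfies `(u, h) = 1`, so that `u` is not proportional
to `x`. -/
theorem exists_k3Form_eq (x y : K3Lattice) (N : ℤ) :
    ∃ u h : K3Lattice, k3Form x u = k3Form x y ∧ k3Form u u = 2 * N ∧ k3Form x h = 0 ∧
      k3Form u h = 1 := by
  obtain ⟨h, h', hx, hx', hh, hh', hp⟩ := exists_orthogonal_hyperbolic_pair x
  have hp' : k3Form h' h = 1 := by rw [k3Form_comm, hp]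
  obtain ⟨n, hn⟩ := even_k3Form_self y
  -- In `u = y + α h + β h'`, the condition `(u, h) = 1` fixes `β`, and `u² = 2 N` is then a
  -- linear equation for `α`.
  set β := 1 - k3Form y h with hβ
  refine ⟨y + (N - n - β * k3Form y h') • h + β • h', h, ?_, ?_, hx, ?_⟩
  · simp [hx, hx', -zsmul_eq_mul]
  · simp only [map_add, map_smul, LinearMap.add_apply, LinearMap.smul_apply, smul_eq_mul, hh, hh',
      hp, hp', hn, k3Form_comm h y, k3Form_comm h' y]
    rw [hβ]
    ring
  · simp [hh, hp', hβ, -zsmul_eq_mul]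

/-! ### The Beauville-Bogomolov-Fujiki lattice -/

theorem bbfForm_apply (k : ℕ) (x y : HilbLattice) :
    bbfForm k x y = k3Form x.1 y.1 + -2 * ((k : ℤ) - 1) * (x.2 * y.2) := rfl

theorem bbfForm_comm (k : ℕ) (x y : HilbLattice) : bbfForm k x y = bbfForm k y x := by
  rw [bbfForm_apply, bbfForm_apply, k3Form_comm, mul_comm x.2]

/-- The reflection in `u + e`, where `u` lies in the K3 lattice and `u² = 2 (k - 1) - 2`. -/
theorem exists_reflection_add_diagClass {k : ℕ} {u : K3Lattice}
    (hu : k3Form u u = 2 * ((k : ℤ) - 2)) :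
    ∃ γ ∈ stableOrthogonalGroup (bbfForm k) ⊓ monodromyGroup (bbfForm k), ∀ x,
      γ x = (x.1 + (k3Form x.1 u - 2 * ((k : ℤ) - 1) * x.2) • u,
        x.2 + (k3Form x.1 u - 2 * ((k : ℤ) - 1) * x.2)) := by
  obtain ⟨γ, hγ, h⟩ := exists_reflection_mem (bbfForm_comm k) (u := (u, 1))
    (by rw [bbfForm_apply, hu]; ring)
  refine ⟨γ, hγ, fun x => ?_⟩
  have hB : bbfForm k x (u, 1) = k3Form x.1 u - 2 * ((k : ℤ) - 1) * x.2 := by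
    rw [bbfForm_apply]; ring
  rw [h, hB]
  ext <;> simp

/-- `z` has a nonzero component in the K3 lattice, and among the vectors of its orbit under
`Õ ∩ Mon` with this property its coefficient at `e` has the smallest absolute value. -/
def HasMinimalCoeff (k : ℕ) (z : HilbLattice) : Prop :=
  z.1 ≠ 0 ∧ ∀ γ ∈ stableOrthogonalGroup (bbfForm k) ⊓ monodromyGroup (bbfForm k),
    (γ z).1 ≠ 0 → |z.2| ≤ |(γ z).2|

theorem add_smul_ne_zero {x u h : K3Lattice} {β : ℤ} (hx : k3Form x h = 0) (hu : k3Form u h = 1)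
    (hβ : x ≠ 0 ∨ β ≠ 0) : x + β • u ≠ 0 := by
  intro h0
  have h1 : β = 0 := by
    have := congrArg (fun v => k3Form v h) h0
    simpa [hx, hu, -zsmul_eq_mul] using this
  rcases hβ with h2 | h2
  · exact h2 (by simpa [h1] using h0)
  · exact h2 h1

theorem exists_hasMinimalCoeff {k : ℕ} (hk : 2 ≤ k) {z : HilbLattice} (hz : z ≠ 0) :
    ∃ γ ∈ stableOrthogonalGroup (bbfForm k) ⊓ monodromyGroup (bbfForm k),
      HasMinimalCoeff k (γ z) := by
  classical
  have hex : ∃ n : ℕ, ∃ γ ∈ stableOrthogonalGroup (bbfForm k) ⊓ monodromyGroup (bbfForm k),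
      (γ z).1 ≠ 0 ∧ (γ z).2.natAbs = n := by
    by_cases h1 : z.1 = 0
    · have h2 : z.2 ≠ 0 := fun h2 => hz (Prod.ext h1 h2)
      obtain ⟨u, h, hxu, huu, hxh, huh⟩ := exists_k3Form_eq z.1 0 ((k : ℤ) - 2)
      obtain ⟨γ, hγ, hγz⟩ := exists_reflection_add_diagClass huu
      refine ⟨_, γ, hγ, ?_, rfl⟩
      rw [hγz]
      refine add_smul_ne_zero hxh huh (Or.inr ?_)
      rw [hxu, map_zero, zero_sub, neg_ne_zero]
      exact mul_ne_zero (by omega) h2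
    · exact ⟨_, 1, one_mem _, h1, rfl⟩
  obtain ⟨γ, hγ, h1, h2⟩ := Nat.find_spec hex
  refine ⟨γ, hγ, h1, fun δ hδ h3 => ?_⟩
  have := Nat.find_min' hex ⟨δ * γ, mul_mem hδ hγ, h3, rfl⟩
  rw [← h2] at this
  have h4 : (δ * γ) z = δ (γ z) := rfl
  rw [h4] at this
  rw [Int.abs_eq_natAbs, Int.abs_eq_natAbs]
  exact_mod_cast this

/-- The reflections in the classes `u + e` change the coefficient `a` of `e` to
`(1 - 2 (k - 1)) a + (x, u)`, where `(x, u)` is an arbitrary multiple of the divisibility of `x`;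
so the minimal coefficient is at most half of this divisibility. -/
theorem HasMinimalCoeff.two_mul_abs_le {k : ℕ} {z : HilbLattice} (hz : HasMinimalCoeff k z)
    {c : ℤ} (hc : 0 < c) {y : K3Lattice} (hy : k3Form z.1 y = c) : 2 * |z.2| ≤ c := by
  obtain ⟨m, hm⟩ : ∃ m : ℤ, 2 * |(1 - 2 * ((k : ℤ) - 1)) * z.2 + m * c| ≤ c := by
    generalize (1 - 2 * ((k : ℤ) - 1)) * z.2 = b
    have h1 := Int.emod_nonneg b hc.ne'
    have h2 := Int.emod_lt_of_pos b hc
    have h3 := Int.emod_def b c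
    by_cases h : 2 * (b % c) ≤ c
    · refine ⟨-(b / c), ?_⟩
      rw [show b + -(b / c) * c = b % c by rw [h3]; ring, abs_of_nonneg h1]
      exact h
    · refine ⟨-(b / c) - 1, ?_⟩
      rw [show b + (-(b / c) - 1) * c = b % c - c by rw [h3]; ring, abs_of_neg (by omega)]
      omega
  obtain ⟨u, h, hxu, huu, hxh, huh⟩ := exists_k3Form_eq z.1 (m • y) ((k : ℤ) - 2)
  obtain ⟨γ, hγ, hγz⟩ := exists_reflection_add_diagClass huu
  have hmin := hz.2 γ hγ (by rw [hγz]; exact add_smul_ne_zero hxh huh (Or.inl hz.1))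
  rw [hγz, hxu, map_smul, hy, smul_eq_mul] at hmin
  rw [show (1 - 2 * ((k : ℤ) - 1)) * z.2 + m * c
    = z.2 + (m * c - 2 * ((k : ℤ) - 1) * z.2) by ring] at hm
  linarith

theorem finrank_pairLattice_diagClass {z : HilbLattice} (hz : z.1 ≠ 0) :
    Module.finrank ℤ (pairLattice z diagClass) = 2 := by
  have hli : LinearIndependent ℤ ![z, diagClass] := by
    rw [LinearIndependent.pair_iff]
    intro s t h
    have h1 : s • z.1 = 0 := by simpa [diagClass] using congrArg Prod.fst h
    have h2 : s = 0 := (smul_eq_zero.1 h1).resolve_right hz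
    have h3 := congrArg Prod.snd h
    exact ⟨h2, by simpa [diagClass, h2] using h3⟩
  have := finrank_span_eq_card hli
  rwa [Matrix.range_cons, Matrix.range_cons, Matrix.range_empty, Set.union_empty,
    Set.singleton_union, Fintype.card_fin] at this

theorem fst_ne_zero_of_finrank_pairLattice {z : HilbLattice}
    (h : Module.finrank ℤ (pairLattice z diagClass) = 2) : z.1 ≠ 0 := by
  intro h1
  have hz : z ∈ Submodule.span ℤ {diagClass} :=
    Submodule.mem_span_singleton.2 ⟨z.2, by ext <;> simp [diagClass, h1]⟩
  have := finrank_span_le_card (R := ℤ) ({diagClass} : Set HilbLattice)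
  rw [pairLattice, Submodule.span_insert_eq_span hz] at h
  simp at this
  omega

/-- The lattice `⟨z, e⟩` contains the K3 component of `z`. -/
theorem fst_mem_pairLattice (z : HilbLattice) : (z.1, 0) ∈ pairLattice z diagClass :=
  Submodule.mem_span_pair.2 ⟨1, -z.2, by ext <;> simp [diagClass]⟩

theorem negSemidefOn_pairLattice {k : ℕ} (hk : 2 ≤ k) {z : HilbLattice}
    (hz : k3Form z.1 z.1 ≤ 0) : NegSemidefOn (bbfForm k) (pairLattice z diagClass) := by
  intro w hw
  obtain ⟨s, t, rfl⟩ := Submodule.mem_span_pair.1 hw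
  have h1 := mul_nonneg (sq_nonneg s) (neg_nonneg.2 hz)
  have h2 : 0 ≤ ((k : ℤ) - 1) * (s * z.2 + t) ^ 2 := mul_nonneg (by omega) (sq_nonneg _)
  rw [bbfForm_apply]
  simp [diagClass, -zsmul_eq_mul]
  nlinarith

theorem negDefOn_pairLattice {k : ℕ} (hk : 2 ≤ k) {z : HilbLattice}
    (hz : k3Form z.1 z.1 < 0) : NegDefOn (bbfForm k) (pairLattice z diagClass) := by
  intro w hw hw0
  obtain ⟨s, t, rfl⟩ := Submodule.mem_span_pair.1 hw
  have hk' : (0 : ℤ) < (k : ℤ) - 1 := by omega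
  have hval : bbfForm k (s • z + t • diagClass) (s • z + t • diagClass)
      = -(s ^ 2 * -k3Form z.1 z.1 + 2 * (((k : ℤ) - 1) * (s * z.2 + t) ^ 2)) := by
    rw [bbfForm_apply]
    simp [diagClass, -zsmul_eq_mul]
    ring
  rw [hval, neg_lt_zero]
  by_cases hs : s = 0
  · subst hs
    have ht : t ≠ 0 := by
      rintro rfl
      simp at hw0
    have := mul_pos hk' (by positivity : 0 < t ^ 2)
    simpa using this
  · have h1 := mul_pos (by positivity : 0 < s ^ 2) (neg_pos.2 hz)
    have h2 := mul_nonneg hk'.le (sq_nonneg (s * z.2 + t))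
    linarith

/-- If `2 |a| ≤ c` and `z = c x₀ + a e` has negative square, then `x₀² < (k - 1) / 2`; for `k ≤ 5`
this bound is at most `2`, and `x₀²` is even. -/
theorem HasMinimalCoeff.k3Form_nonpos {k : ℕ} (hk : 2 ≤ k) (hk5 : k ≤ 5) {z : HilbLattice}
    (hz : HasMinimalCoeff k z) (hneg : bbfForm k z z < 0) : k3Form z.1 z.1 ≤ 0 := by
  obtain ⟨c, hc, ⟨x₀, hx₀⟩, y, hy⟩ := exists_divisibility hz.1
  have hle := hz.two_mul_abs_le hc hy
  obtain ⟨n, hn⟩ := even_k3Form_self x₀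
  have hx : k3Form z.1 z.1 = c ^ 2 * (n + n) := by
    rw [hx₀]
    simp only [map_smul, LinearMap.smul_apply, smul_eq_mul, hn]
    ring
  rw [bbfForm_apply, hx] at hneg
  have ha : 4 * z.2 ^ 2 ≤ c ^ 2 := by
    have := pow_le_pow_left₀ (by positivity) hle 2
    rwa [mul_pow, sq_abs] at this
  rw [hx]
  by_contra! hcon
  have hn1 : 1 ≤ n := by
    by_contra! h
    have := mul_nonneg (sq_nonneg c) (by omega : 0 ≤ -(n + n))
    linarith
  have h1 := mul_nonneg (sq_nonneg c) (by omega : 0 ≤ n - 1)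
  have h2 := mul_nonneg (sq_nonneg z.2) (by omega : 0 ≤ 5 - (k : ℤ))
  nlinarith

/-- For `k = 2`, a primitive vector of minimal coefficient and negative square whose K3 component
is isotropic lies in the orbit of `e`. -/
theorem HasMinimalCoeff.exists_apply_eq_diagClass {z : HilbLattice} (hz : HasMinimalCoeff 2 z)
    (hprim : IsPrimitiveVector z) (hneg : bbfForm 2 z z < 0) (h0 : k3Form z.1 z.1 = 0) :
    ∃ γ ∈ stableOrthogonalGroup (bbfForm 2), γ z = diagClass := by
  have ha : z.2 ≠ 0 := by
    intro h
    rw [bbfForm_apply, h0, h] at hneg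
    simp at hneg
  -- A first reflection, in `u + e` with `u ⊥ z.1`, keeps `|a|` and yields a vector `w` whose K3
  -- component has a divisibility dividing `2 a`; by minimality it equals `2 |a|`.
  obtain ⟨u, h, hxu, huu, hxh, huh⟩ := exists_k3Form_eq z.1 0 (((2 : ℕ) : ℤ) - 2)
  obtain ⟨γ, hγ, hγz⟩ := exists_reflection_add_diagClass huu
  rw [map_zero] at hxu
  have hw : γ z = (z.1 + (-2 * z.2) • u, -z.2) := by
    rw [hγz, hxu]
    ext <;> push_cast <;> ring_nf
  have hw0 : (γ z).1 ≠ 0 := by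
    rw [hw]
    exact add_smul_ne_zero hxh huh (Or.inl hz.1)
  have hwmin : HasMinimalCoeff 2 (γ z) := by
    refine ⟨hw0, fun δ hδ h1 => ?_⟩
    have := hz.2 (δ * γ) (mul_mem hδ hγ) h1
    rw [LinearEquiv.mul_apply] at this
    rw [hw]
    rw [hw] at this
    simpa using this
  have hwh : k3Form (γ z).1 h = -2 * z.2 := by
    rw [hw]
    simp [hxh, huh, -zsmul_eq_mul]
  have hww : k3Form (γ z).1 (γ z).1 = 0 := by
    have huz : k3Form u z.1 = 0 := by rw [k3Form_comm, hxu]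
    rw [hw]
    simp [h0, hxu, huz, huu, -zsmul_eq_mul]
  obtain ⟨c, hc, ⟨x₀, hx₀⟩, y, hy⟩ := exists_divisibility hw0
  have hle := hwmin.two_mul_abs_le hc hy
  have hw2 : (γ z).2 = -z.2 := by rw [hw]
  rw [hw2, abs_neg] at hle
  have hdvd : c ∣ 2 * z.2 := by
    rw [hx₀, map_smul, LinearMap.smul_apply, smul_eq_mul] at hwh
    exact ⟨-k3Form x₀ h, by linarith⟩
  have hc2 : c = 2 * |z.2| := by
    refine le_antisymm (Int.le_of_dvd (by positivity) ?_) hle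
    rwa [show 2 * |z.2| = |2 * z.2| by rw [abs_mul]; rfl, dvd_abs]
  obtain ⟨ε, hε⟩ : z.2 ∣ |z.2| := (dvd_abs _ _).2 dvd_rfl
  -- Hence `a` divides `w`, so `a = ± 1` and `w = 2 x₀ ± e` with `x₀² = 0`.
  have hunit : IsUnit z.2 := by
    refine hprim.map γ z.2 ((2 * ε) • x₀, -1) ?_
    refine Prod.ext ?_ ?_
    · rw [hx₀, hc2, hε, Prod.smul_fst, smul_smul]
      congr 1
      ring
    · rw [hw2]
      simp
  have habs : |z.2| = 1 := Int.isUnit_iff_abs_eq.1 hunit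
  rw [habs, mul_one] at hc2
  subst hc2
  have hx₀0 : k3Form x₀ x₀ = 0 := by
    rw [hx₀] at hww
    simpa [-zsmul_eq_mul] using hww
  have hsq : z.2 * z.2 = 1 := by rw [← abs_mul_abs_self, habs, one_mul]
  -- The reflection in `- a x₀ + e` maps `w = 2 x₀ - a e` to `a e`.
  obtain ⟨δ, hδ, hδw⟩ := exists_reflection_add_diagClass (k := 2) (u := -z.2 • x₀)
    (by simp [hx₀0, -zsmul_eq_mul])
  have hδγ : δ (γ z) = z.2 • diagClass := by
    rw [hδw, hx₀, hw2]
    simp only [map_smul, LinearMap.smul_apply, hx₀0, diagClass]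
    refine Prod.ext ?_ ?_
    · simp only [smul_zero, smul_smul, ← add_smul, Prod.smul_fst]
      rw [show (2 : ℤ) + (0 - 2 * (((2 : ℕ) : ℤ) - 1) * -z.2) * -z.2 = 0 by
        push_cast; linear_combination (-2) * hsq, zero_smul]
    · simp
      ring
  rcases Int.isUnit_iff.1 hunit with h1 | h1
  · exact ⟨δ * γ, (mul_mem hδ hγ).1, by rw [LinearEquiv.mul_apply, hδγ, h1, one_smul]⟩
  · have hee : bbfForm 2 diagClass diagClass = -2 := by
      rw [bbfForm_apply]
      simp [diagClass]
    obtain ⟨ρ, hρ, hρx⟩ := exists_reflection_mem (bbfForm_comm 2) hee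
    refine ⟨ρ * (δ * γ), mul_mem hρ.1 (mul_mem hδ hγ).1, ?_⟩
    rw [LinearEquiv.mul_apply, LinearEquiv.mul_apply, hδγ, h1, map_smul, hρx, hee]
    module

/-- A vector whose product with all others is even has its K3 component in `2 H²(S, ℤ)`. -/
theorem exists_fst_eq_two_smul {k : ℕ} {w : HilbLattice} (h : ∀ v, 2 ∣ bbfForm k w v) :
    ∃ x₀ : K3Lattice, w.1 = (2 : ℤ) • x₀ := by
  refine exists_eq_smul_of_dvd_k3Form fun y => ?_
  have := h (y, 0)
  rwa [bbfForm_apply, mul_zero, mul_zero, add_zero] at this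

theorem two_dvd_bbfForm_apply {k : ℕ} {γ : HilbLattice ≃ₗ[ℤ] HilbLattice}
    (hγ : γ ∈ isometryGroup (bbfForm k)) {z : HilbLattice} (h : ∀ v, 2 ∣ bbfForm k z v)
    (v : HilbLattice) : 2 ∣ bbfForm k (γ z) v := by
  have := hγ z (γ.symm v)
  rw [γ.apply_symm_apply] at this
  rw [this]
  exact h _

theorem two_dvd_bbfForm_two_smul_add {k : ℕ} (x : K3Lattice) (a : ℤ) (v : HilbLattice) :
    2 ∣ bbfForm k ((2 : ℤ) • x, a) v := by
  rw [bbfForm_apply, map_smul, LinearMap.smul_apply, smul_eq_mul]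
  exact ⟨k3Form x v.1 - ((k : ℤ) - 1) * (a * v.2), by ring⟩

/-- For `k = 2`, if an isometry maps `e` to `w = 2 x₀ + a e`, then `x₀² = (a² - 1) / 2`
is even, so `a ≠ 0` and `x₀² ≥ 0`; hence `⟨w, e⟩` is not negative definite of rank `2`. -/
theorem not_negDefOn_of_apply_diagClass {σ : HilbLattice ≃ₗ[ℤ] HilbLattice}
    (hσ : σ ∈ isometryGroup (bbfForm 2)) (h1 : (σ diagClass).1 ≠ 0) :
    ¬ NegDefOn (bbfForm 2) (pairLattice (σ diagClass) diagClass) := by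
  intro hdef
  have hlt := hdef _ (fst_mem_pairLattice _) (fun h => h1 (congrArg Prod.fst h))
  have he : (diagClass : HilbLattice) = ((2 : ℤ) • 0, 1) := by rw [smul_zero]; rfl
  obtain ⟨x₀, hx₀⟩ := exists_fst_eq_two_smul (k := 2) (two_dvd_bbfForm_apply hσ
    (z := diagClass) (by rw [he]; exact two_dvd_bbfForm_two_smul_add 0 1))
  have hsq := hσ diagClass diagClass
  obtain ⟨n, hn⟩ := even_k3Form_self x₀
  rw [bbfForm_apply, bbfForm_apply, hx₀] at hsq
  rw [bbfForm_apply, hx₀] at hlt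
  generalize (σ diagClass).2 = a at *
  simp [diagClass, hn, -zsmul_eq_mul] at hsq hlt
  have ha : a = 0 := by
    by_contra h
    have : 0 < a * a := lt_of_le_of_ne (mul_self_nonneg a) (mul_self_ne_zero.2 h).symm
    omega
  subst ha
  omega

/-- An isometry maps the primitive vector `2 w + e`, `w² = 2`, to some `2 x₀ + a e` with `a ≠ 0`, and
`4 x₀² = 8 - 2 (k - 1) + 2 (k - 1) a² ≥ 8`. -/
theorem not_negSemidefOn_of_apply {k : ℕ} (hk : 2 ≤ k) {w : K3Lattice} (hw : k3Form w w = 2)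
    {γ : HilbLattice ≃ₗ[ℤ] HilbLattice} (hγ : γ ∈ isometryGroup (bbfForm k))
    (hprim : IsPrimitiveVector (((2 : ℤ) • w, 1) : HilbLattice)) :
    ¬ NegSemidefOn (bbfForm k) (pairLattice (γ ((2 : ℤ) • w, 1)) diagClass) := by
  intro hdef
  have hle := hdef _ (fst_mem_pairLattice _)
  obtain ⟨x₀, hx₀⟩ := exists_fst_eq_two_smul
    (two_dvd_bbfForm_apply hγ (two_dvd_bbfForm_two_smul_add w 1))
  have hsq := hγ ((2 : ℤ) • w, 1) ((2 : ℤ) • w, 1)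
  have ha : (γ ((2 : ℤ) • w, 1)).2 ≠ 0 := by
    intro h
    have := hprim.map γ 2 (x₀, 0) (Prod.ext hx₀ (by rw [h]; rfl))
    exact absurd this (by decide)
  rw [bbfForm_apply, bbfForm_apply] at hsq
  rw [bbfForm_apply] at hle
  simp only [map_smul, LinearMap.smul_apply, hw, smul_eq_mul, mul_zero, add_zero] at hsq hle
  have h1 : 0 < (γ ((2 : ℤ) • w, 1)).2 * (γ ((2 : ℤ) • w, 1)).2 :=
    lt_of_le_of_ne (mul_self_nonneg _) (mul_self_ne_zero.2 ha).symm
  have h2 : 0 ≤ ((k : ℤ) - 1) * ((γ ((2 : ℤ) • w, 1)).2 * (γ ((2 : ℤ) • w, 1)).2 - 1) :=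
    mul_nonneg (by omega) (by omega)
  linarith

/-! ### Negative planes through the class `e` -/

theorem mainTheorem5 :
    -- the case `k = 2`
    (∀ z : HilbLattice, IsPrimitiveVector z → bbfForm 2 z z < 0 →
      ((∃ γ : HilbLattice ≃ₗ[ℤ] HilbLattice,
          γ ∈ stableOrthogonalGroup (bbfForm 2) ∧ γ ∈ monodromyGroup (bbfForm 2) ∧
          Module.finrank ℤ (pairLattice (γ z) diagClass) = 2 ∧
          NegDefOn (bbfForm 2) (pairLattice (γ z) diagClass)) ↔
        ¬ ∃ γ ∈ stableOrthogonalGroup (bbfForm 2), γ z = diagClass)) ∧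
    -- the case `3 ≤ k ≤ 5`
    (∀ k : ℕ, 3 ≤ k → k ≤ 5 →
      ∀ z : HilbLattice, IsPrimitiveVector z → bbfForm k z z < 0 →
        ∃ γ : HilbLattice ≃ₗ[ℤ] HilbLattice,
          γ ∈ stableOrthogonalGroup (bbfForm k) ∧ γ ∈ monodromyGroup (bbfForm k) ∧
          Module.finrank ℤ (pairLattice (γ z) diagClass) = 2 ∧
          NegSemidefOn (bbfForm k) (pairLattice (γ z) diagClass)) ∧
    -- failure from `k = 6` on
    (∀ k : ℕ, 6 ≤ k →
      ∃ z : HilbLattice, IsPrimitiveVector z ∧ bbfForm k z z < 0 ∧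
        ∀ γ : HilbLattice ≃ₗ[ℤ] HilbLattice,
          (γ ∈ stableOrthogonalGroup (bbfForm k) ∨ γ ∈ monodromyGroup (bbfForm k)) →
          ¬ NegSemidefOn (bbfForm k) (pairLattice (γ z) diagClass)) := by
  refine ⟨fun z hprim hneg => ⟨?_, fun horb => ?_⟩, fun k hk3 hk5 z hprim hneg => ?_,
    fun k hk => ?_⟩
  · rintro ⟨γ, hγ, -, hrank, hdef⟩ ⟨δ, hδ, hδz⟩
    have hz : γ z = (γ * δ⁻¹) diagClass := by
      rw [LinearEquiv.mul_apply, ← hδz]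
      exact congrArg γ (δ.symm_apply_apply z).symm
    rw [hz] at hrank hdef
    exact not_negDefOn_of_apply_diagClass (mul_mem hγ.1 (inv_mem hδ.1))
      (fst_ne_zero_of_finrank_pairLattice hrank) hdef
  · obtain ⟨γ, hγ, hmin⟩ := exists_hasMinimalCoeff le_rfl hprim.ne_zero
    have hneg' : bbfForm 2 (γ z) (γ z) < 0 := by rwa [hγ.1.1]
    refine ⟨γ, hγ.1, hγ.2, finrank_pairLattice_diagClass hmin.1, negDefOn_pairLattice le_rfl
      (lt_of_le_of_ne (hmin.k3Form_nonpos le_rfl (by norm_num) hneg') fun h0 => horb ?_)⟩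
    obtain ⟨δ, hδ, h⟩ := hmin.exists_apply_eq_diagClass (hprim.map γ) hneg' h0
    exact ⟨δ * γ, mul_mem hδ hγ.1, h⟩
  · have hk : 2 ≤ k := by omega
    obtain ⟨γ, hγ, hmin⟩ := exists_hasMinimalCoeff hk hprim.ne_zero
    have hneg' : bbfForm k (γ z) (γ z) < 0 := by rwa [hγ.1.1]
    exact ⟨γ, hγ.1, hγ.2, finrank_pairLattice_diagClass hmin.1,
      negSemidefOn_pairLattice hk (hmin.k3Form_nonpos hk hk5 hneg')⟩
  · obtain ⟨w, -, -, hw, -⟩ := exists_k3Form_eq 0 0 1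
    rw [mul_one] at hw
    have hprim : IsPrimitiveVector (((2 : ℤ) • w, 1) : HilbLattice) := fun n v hv =>
      IsUnit.of_mul_eq_one v.2 (congrArg Prod.snd hv).symm
    refine ⟨((2 : ℤ) • w, 1), hprim, ?_, fun γ hγ => not_negSemidefOn_of_apply (by omega) hw
      (hγ.elim (fun h => h.1) fun h => monodromyGroup_le_isometryGroup h) hprim⟩
    rw [bbfForm_apply]
    simp only [map_smul, LinearMap.smul_apply, hw, smul_eq_mul]
    omega
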